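/- Let $(W,S)$ be a Coxeter system ($S$ possibly infinite) with length function $l$, and let $\le$ be the (right) weak order on $W$: $x\le y$ if and only if $l(y)=l(x)+l(x^{-1}y)$. Let $x\in W$. Then: (a) The map $u\mapsto xu$ restricts to an order isomorphism from the subposet $\{u\in W : l(xu)=l(x)+l(u)\}$ of $(W,\le)$, which is an order ideal (down-closed), onto the subposet $\{z\in W : x\le z\}$, which is an order coideal (up-closed). (b) If $U\subseteq W$ satisfies $l(xu)=l(x)+l(u)$ for all $u\in U$, and the join (least upper bound) $y=\bigvee U$ exists in $(W,\le)$, then $l(xy)=l(x)+l(y)$. Moreover, let $\Phi$ be a based root system of $(W,S)$ in a real vector space $V$: $V$ carries a symmetric bilinear form and vectors $\alpha_s$ $(s\in S)$, positively independent (a vanishing finite linear combination with nonnegative coefficients is trivial), with $\langle\alpha_s,\alpha_s\rangle=1$ and, for $s\ne t$, $\langle\alpha_s,\alpha_t\rangle=-\cos(\pi/m)$ if the order $m$ of $st$ is finite, and $\langle\alpha_s,\alpha_t\rangle\le -1$ if $st$ has infinite order. Let $W$ act on $V$ with each $s\in S$ acting by $v\mapsto v-2\langle\alpha_s,v\rangle\alpha_s$;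 let $\Phi=\{w\alpha_s : w\in W,\ s\in S\}$, let $\Phi_+$ be the set of roots that are nonnegative linear combinations of the $\alpha_s$, $\Phi_-=-\Phi_+$, and $\Phi_z=\Phi_+\cap z(\Phi_-)$ for $z\in W$. Then for every $u\in W$ the condition $l(xu)=l(x)+l(u)$ used above is equivalent to $\Phi_u\cap\Phi_{x^{-1}}=\emptyset$. -/

import Mathlib

namespace CoxeterSystem

section WeakOrder

variable {B : Type*} {W : Type*} [Group W] {M : CoxeterMatrix B} (cs : CoxeterSystem M W)

/-- The (right) weak order on `W`: `x ≤ y` if and only if `ℓ(y) = ℓ(x) + ℓ(x⁻¹ y)`. -/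
@[reducible]
def weakOrder : PartialOrder W where
  le x y := cs.length y = cs.length x + cs.length (x⁻¹ * y)
  le_refl x := by simp
  le_trans x y z h₁ h₂ := by
    have h₃ := cs.length_mul_le (x⁻¹ * y) (y⁻¹ * z)
    have h₄ := cs.length_mul_le x (x⁻¹ * z)
    have e₃ : x⁻¹ * y * (y⁻¹ * z) = x⁻¹ * z := by group
    have e₄ : x * (x⁻¹ * z) = z := by group
    rw [e₃] at h₃
    rw [e₄] at h₄
    show cs.length z = cs.length x + cs.length (x⁻¹ * z)
    have h₁' : cs.length y = cs.length x + cs.length (x⁻¹ * y) := h₁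
    have h₂' : cs.length z = cs.length y + cs.length (y⁻¹ * z) := h₂
    omega
  le_antisymm x y h₁ h₂ := by
    have h₁' : cs.length y = cs.length x + cs.length (x⁻¹ * y) := h₁
    have h₂' : cs.length x = cs.length y + cs.length (y⁻¹ * x) := h₂
    have h₃ : cs.length (x⁻¹ * y) = 0 := by omega
    exact inv_mul_eq_one.mp (cs.length_eq_zero_iff.mp h₃)

end WeakOrder

end CoxeterSystem

/-- A based root system in the real vector space `V` for the Coxeter matrix `M`: a symmetric
bilinear form on `V` and a positively independent family of simple roots of norm one, whose
pairwise inner products are `-cos (π / m)` where the corresponding entry `m` of `M` is finite, and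
at most `-1` where it is infinite (an infinite entry of a Coxeter matrix is encoded as `0`). -/
structure BasedRootSystem {B : Type*} (M : CoxeterMatrix B) (V : Type*) [AddCommGroup V]
    [Module ℝ V] where
  /-- The bilinear form. -/
  form : LinearMap.BilinForm ℝ V
  /-- The simple roots. -/
  simpleRoot : B → V
  form_symm : ∀ v w : V, form v w = form w v
  form_self : ∀ i : B, form (simpleRoot i) (simpleRoot i) = 1
  form_of_finite : ∀ i j : B, i ≠ j → M i j ≠ 0 →
    form (simpleRoot i) (simpleRoot j) = -Real.cos (Real.pi / (M i j : ℝ))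
  form_of_infinite : ∀ i j : B, i ≠ j → M i j = 0 → form (simpleRoot i) (simpleRoot j) ≤ -1
  /-- The only nonnegative linear combination of simple roots that vanishes is the trivial one. -/
  pos_indep : ∀ c : B →₀ ℝ, (∀ i, 0 ≤ c i) → (c.sum fun i a => a • simpleRoot i) = 0 → c = 0

namespace BasedRootSystem

variable {B : Type*} {M : CoxeterMatrix B} {V : Type*} [AddCommGroup V] [Module ℝ V]
  (R : BasedRootSystem M V)

/-- The linear functional `v ↦ 2 ⟨αᵢ, v⟩`. -/
def simpleCoroot (i : B) : Module.Dual ℝ V := (2 : ℝ) • R.form (R.simpleRoot i)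

theorem simpleCoroot_simpleRoot (i : B) : R.simpleCoroot i (R.simpleRoot i) = 2 := by
  simp [simpleCoroot, R.form_self i]

/-- The reflection `v ↦ v - 2 ⟨αᵢ, v⟩ αᵢ` in the simple root `αᵢ`. -/
def simpleReflection (i : B) : V ≃ₗ[ℝ] V := Module.reflection (R.simpleCoroot_simpleRoot i)

theorem simpleReflection_apply (i : B) (v : V) :
    R.simpleReflection i v = v - (2 * R.form (R.simpleRoot i) v) • R.simpleRoot i := by
  simp [simpleReflection, Module.reflection_apply, simpleCoroot]

open Polynomial.Chebyshev in
theorem chebyshev_aux (m : ℕ) (hm : 3 ≤ m) :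
    (S ℝ (((m : ℤ) - 2) / 2)).eval (2 * Real.cos (2 * Real.pi / m)) *
        ((S ℝ (((m : ℤ) - 1) / 2)).eval (2 * Real.cos (2 * Real.pi / m)) +
          (S ℝ (((m : ℤ) - 3) / 2)).eval (2 * Real.cos (2 * Real.pi / m))) = 0 ∧
      (S ℝ (((m : ℤ) - 1) / 2)).eval (2 * Real.cos (2 * Real.pi / m)) *
        ((S ℝ ((m : ℤ) / 2)).eval (2 * Real.cos (2 * Real.pi / m)) +
          (S ℝ (((m : ℤ) - 2) / 2)).eval (2 * Real.cos (2 * Real.pi / m))) = 0 := by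
  have hm' : (3 : ℝ) ≤ m := by exact_mod_cast hm
  have hm0 : (m : ℝ) ≠ 0 := by positivity
  set φ : ℝ := 2 * Real.pi / m with hφ
  have hmφ : (m : ℝ) * φ = 2 * Real.pi := by rw [hφ]; field_simp
  have hs : Real.sin φ ≠ 0 := by
    apply ne_of_gt
    apply Real.sin_pos_of_pos_of_lt_pi
    · rw [hφ]; positivity
    · rw [hφ, div_lt_iff₀ (by positivity)]
      nlinarith [Real.pi_pos]
  rcases Nat.even_or_odd' m with ⟨k, hk | hk⟩
  · have hkφ : (k : ℝ) * φ = Real.pi := by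
      rw [hk] at hmφ; push_cast at hmφ; linarith
    have h0 : (S ℝ ((k : ℤ) - 1)).eval (2 * Real.cos φ) = 0 := by
      have h := S_two_mul_real_cos φ ((k : ℤ) - 1)
      push_cast at h
      rw [sub_add_cancel, hkφ, Real.sin_pi] at h
      exact (mul_eq_zero.mp h).resolve_right hs
    have e1 : ((m : ℤ) - 2) / 2 = (k : ℤ) - 1 := by omega
    have e2 : ((m : ℤ) - 1) / 2 = (k : ℤ) - 1 := by omega
    rw [e1, e2, h0]
    simp
  · have hkφ : (k : ℝ) * φ = Real.pi - φ / 2 := by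
      rw [hk] at hmφ; push_cast at hmφ; linarith
    have h0 : (S ℝ (k : ℤ)).eval (2 * Real.cos φ) +
        (S ℝ ((k : ℤ) - 1)).eval (2 * Real.cos φ) = 0 := by
      have h₁ := S_two_mul_real_cos φ (k : ℤ)
      have h₂ := S_two_mul_real_cos φ ((k : ℤ) - 1)
      push_cast at h₁ h₂
      rw [add_mul, hkφ, one_mul] at h₁
      rw [sub_add_cancel, hkφ, Real.sin_pi_sub] at h₂
      have h₃ : Real.sin (Real.pi - φ / 2 + φ) = -Real.sin (φ / 2) := by
        rw [show Real.pi - φ / 2 + φ = φ / 2 + Real.pi by ring, Real.sin_add_pi]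
      rw [h₃] at h₁
      have h₄ : ((S ℝ (k : ℤ)).eval (2 * Real.cos φ) +
          (S ℝ ((k : ℤ) - 1)).eval (2 * Real.cos φ)) * Real.sin φ = 0 := by
        rw [add_mul, h₁, h₂]; ring
      exact (mul_eq_zero.mp h₄).resolve_right hs
    have e1 : ((m : ℤ) - 1) / 2 = (k : ℤ) := by omega
    have e2 : ((m : ℤ) - 3) / 2 = (k : ℤ) - 1 := by omega
    have e3 : (m : ℤ) / 2 = (k : ℤ) := by omega
    have e4 : ((m : ℤ) - 2) / 2 = (k : ℤ) - 1 := by omega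
    rw [e1, e2, e3, e4, h0]
    simp

/-- The simple reflections satisfy the Coxeter relations. -/
theorem isLiftable_simpleReflection : M.IsLiftable R.simpleReflection := by
  intro i j
  by_cases hij : i = j
  · subst hij
    rw [M.diagonal i, pow_one]
    ext v
    simpa [simpleReflection, LinearEquiv.mul_apply] using
      Module.involutive_reflection (R.simpleCoroot_simpleRoot i) v
  by_cases h0 : M i j = 0
  · rw [h0, pow_zero]
  have h1 : M i j ≠ 1 := fun h => M.off_diagonal i j hij h
  have hf := R.form_of_finite i j hij h0
  have hf' : R.form (R.simpleRoot j) (R.simpleRoot i) = -Real.cos (Real.pi / (M i j : ℝ)) := by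
    rw [R.form_symm, hf]
  by_cases h2 : M i j = 2
  · rw [h2] at hf hf' ⊢
    have hc : -Real.cos (Real.pi / ((2 : ℕ) : ℝ)) = 0 := by simp
    rw [hc] at hf hf'
    ext v
    simp only [pow_two, LinearEquiv.mul_apply, simpleReflection_apply, map_sub, map_smul, hf, hf',
      R.form_self, LinearEquiv.coe_one, id_eq]
    module
  have hm : 3 ≤ M i j := by omega
  have key := chebyshev_aux (M i j) hm
  have ht : 2 * Real.cos (2 * Real.pi / (M i j : ℝ)) =
      R.simpleCoroot i (R.simpleRoot j) * R.simpleCoroot j (R.simpleRoot i) - 2 := by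
    simp only [simpleCoroot, LinearMap.smul_apply, hf, hf', smul_eq_mul]
    rw [show 2 * Real.pi / (M i j : ℝ) = 2 * (Real.pi / (M i j : ℝ)) by ring, Real.cos_two_mul]
    ring
  ext v
  have h := Module.reflection_mul_reflection_pow_apply (R.simpleCoroot_simpleRoot i)
    (R.simpleCoroot_simpleRoot j) (M i j) v (2 * Real.cos (2 * Real.pi / (M i j : ℝ))) ht
  rw [key.1, key.2, zero_smul, zero_smul, add_zero, add_zero] at h
  exact h

variable {W : Type*} [Group W] (cs : CoxeterSystem M W)

/-- The action of `W` on `V`, in which each simple reflection of `W` acts as the reflection in the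
corresponding simple root. -/
def rep : W →* (V ≃ₗ[ℝ] V) := cs.lift ⟨R.simpleReflection, R.isLiftable_simpleReflection⟩

theorem rep_simple (i : B) : R.rep cs (cs.simple i) = R.simpleReflection i :=
  cs.lift_apply_simple R.isLiftable_simpleReflection i

/-- The root system `Φ`: all the images of simple roots under `W`. -/
def roots : Set V := {α | ∃ (w : W) (i : B), α = R.rep cs w (R.simpleRoot i)}

/-- The positive roots `Φ₊`: the roots that are nonnegative linear combinations of simple roots. -/
def posRoots : Set V :=
  {α | α ∈ R.roots cs ∧
    ∃ c : B →₀ ℝ, (∀ i, 0 ≤ c i) ∧ α = c.sum fun i a => a • R.simpleRoot i}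

/-- The negative roots `Φ₋ = -Φ₊`. -/
def negRoots : Set V := {α | -α ∈ R.posRoots cs}

/-- The set `Φ_z = Φ₊ ∩ z(Φ₋)`. -/
def inversionRoots (z : W) : Set V := R.posRoots cs ∩ (R.rep cs z) '' R.negRoots cs

end BasedRootSystem

/-! Everything rests on one fact: `w αᵢ` is a nonnegative or a nonpositive combination of simple
roots according to whether `w sᵢ` is longer or shorter than `w` (`isNonneg_rep_simpleRoot_iff`). Its
proof factors `w` through a rank-two parabolic subgroup, where the coefficients are explicit
Chebyshev values. The root criterion follows by induction on the length of `u`, peeling off a left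
letter: each simple reflection makes only its own simple root negative.

Part (a) is cancellation of lengths, since `(xu)⁻¹(xv) = u⁻¹v`. Part (b) reduces, by induction on
the length of `x`, to `x = sᵢ`: if no element of `U` has left descent `i`, neither does the join
(`not_descent_of_isLUB`). For this, the elements below `y` without left descent `i` are shown to be
directed. By a diamond argument as in Newman's lemma it is enough to treat two covers of one element
(`exists_join_of_covers`). That case is settled in the standard geometric representation, where the
simple roots form a basis and signs can be read off coordinatewise. -/

namespace BasedRootSystem

/-! ### Signs of images of simple roots, and right descents. -/

section Positivity

variable {B : Type*} {M : CoxeterMatrix B} {V : Type*} [AddCommGroup V] [Module ℝ V]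
  (R : BasedRootSystem M V)

/-- The vectors that are nonnegative linear combinations of the simple roots. -/
def IsNonneg (v : V) : Prop :=
  ∃ c : B →₀ ℝ, (∀ i, 0 ≤ c i) ∧ v = c.sum fun i a => a • R.simpleRoot i

variable {R}

theorem IsNonneg.add {v w : V} (hv : R.IsNonneg v) (hw : R.IsNonneg w) : R.IsNonneg (v + w) := by
  obtain ⟨c, hc, rfl⟩ := hv
  obtain ⟨d, hd, rfl⟩ := hw
  refine ⟨c + d, fun i => add_nonneg (hc i) (hd i), ?_⟩
  exact ((Finsupp.linearCombination ℝ R.simpleRoot).map_add c d).symm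

theorem IsNonneg.smul {v : V} (hv : R.IsNonneg v) {a : ℝ} (ha : 0 ≤ a) : R.IsNonneg (a • v) := by
  obtain ⟨c, hc, rfl⟩ := hv
  refine ⟨a • c, fun i => mul_nonneg ha (hc i), ?_⟩
  exact ((Finsupp.linearCombination ℝ R.simpleRoot).map_smul a c).symm

variable (R)

theorem isNonneg_simpleRoot (i : B) : R.IsNonneg (R.simpleRoot i) :=
  ⟨Finsupp.single i 1, fun j => by
    classical rw [Finsupp.single_apply]; split_ifs <;> norm_num, by simp⟩

variable {R}

/-- The cone of nonnegative combinations is pointed; this is where positive independence stands in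
for linear independence. -/
theorem IsNonneg.eq_zero_of_neg {v : V} (hv : R.IsNonneg v) (hv' : R.IsNonneg (-v)) : v = 0 := by
  obtain ⟨c, hc, rfl⟩ := hv
  obtain ⟨d, hd, h⟩ := hv'
  have key : c + d = 0 := by
    refine R.pos_indep (c + d) (fun i => add_nonneg (hc i) (hd i)) ?_
    have e := (Finsupp.linearCombination ℝ R.simpleRoot).map_add c d
    simp only [Finsupp.linearCombination_apply] at e
    rw [e, ← h, add_neg_cancel]
  have hc0 : c = 0 := by
    ext i
    have h1 : c i + d i = 0 := DFunLike.congr_fun key i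
    have := hc i
    have := hd i
    simp only [Finsupp.coe_zero, Pi.zero_apply]
    linarith
  simp [hc0]

variable (R)

theorem form_nonpos {i j : B} (hij : i ≠ j) : R.form (R.simpleRoot i) (R.simpleRoot j) ≤ 0 := by
  by_cases h0 : M i j = 0
  · linarith [R.form_of_infinite i j hij h0]
  · have h1 : M i j ≠ 1 := M.off_diagonal i j hij
    have h2 : (2 : ℝ) ≤ M i j := by exact_mod_cast (by omega : 2 ≤ M i j)
    rw [R.form_of_finite i j hij h0, neg_nonpos]
    apply Real.cos_nonneg_of_mem_Icc
    constructor
    · have : 0 ≤ Real.pi / M i j := by positivity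
      linarith [Real.pi_pos]
    · exact div_le_div_of_nonneg_left Real.pi_pos.le (by norm_num) h2

variable {W : Type*} [Group W] (cs : CoxeterSystem M W)

theorem form_simpleReflection (i : B) (v w : V) :
    R.form (R.simpleReflection i v) (R.simpleReflection i w) = R.form v w := by
  simp only [simpleReflection_apply, map_sub, map_smul, LinearMap.sub_apply, LinearMap.smul_apply,
    smul_eq_mul, R.form_self, R.form_symm v (R.simpleRoot i)]
  ring

theorem form_rep (g : W) (v w : V) : R.form (R.rep cs g v) (R.rep cs g w) = R.form v w := by
  induction g using cs.simple_induction_left with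
  | one => simp
  | mul_simple_left g i ih =>
    rw [map_mul, LinearEquiv.mul_apply, LinearEquiv.mul_apply, rep_simple, form_simpleReflection, ih]

theorem simpleRoot_ne_zero (i : B) : R.simpleRoot i ≠ 0 := fun h => by
  have := R.form_self i
  simp [h] at this

theorem simpleReflection_simpleRoot (i : B) :
    R.simpleReflection i (R.simpleRoot i) = -R.simpleRoot i := by
  rw [simpleReflection_apply, R.form_self]
  module

/-- The coefficients of the images of a simple root under a dihedral group, in terms of
`c = -⟨αᵢ, αⱼ⟩`. -/
def dihedralCoeff (c : ℝ) : ℕ → ℝ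
  | 0 => 0
  | 1 => 1
  | n + 2 => 2 * c * dihedralCoeff c (n + 1) - dihedralCoeff c n

/-- For `c ≥ 1` the recursion is nondecreasing, and this monotonicity has to be carried through the
induction. -/
theorem dihedralCoeff_nonneg_of_one_le {c : ℝ} (hc : 1 ≤ c) (n : ℕ) : 0 ≤ dihedralCoeff c n := by
  have h : 0 ≤ dihedralCoeff c n ∧ dihedralCoeff c n ≤ dihedralCoeff c (n + 1) := by
    induction n with
    | zero => simp [dihedralCoeff]
    | succ n ih =>
      refine ⟨ih.1.trans ih.2, ?_⟩
      rw [dihedralCoeff]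
      nlinarith [mul_nonneg (sub_nonneg.2 hc) (ih.1.trans ih.2)]
  exact h.1

/-- The coefficients are Chebyshev values `sin (nθ) / sin θ`, with the denominator cleared. -/
theorem dihedralCoeff_cos (θ : ℝ) (n : ℕ) :
    dihedralCoeff (Real.cos θ) n * Real.sin θ = Real.sin (n * θ) := by
  induction n using Nat.twoStepInduction with
  | zero => simp [dihedralCoeff]
  | one => simp [dihedralCoeff]
  | more n ih₁ ih₂ =>
    rw [dihedralCoeff, sub_mul, mul_assoc, ih₁, ih₂]
    have e₁ : ((n + 2 : ℕ) : ℝ) * θ = ((n + 1 : ℕ) : ℝ) * θ + θ := by push_cast; ring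
    have e₂ : (n : ℝ) * θ = ((n + 1 : ℕ) : ℝ) * θ - θ := by push_cast; ring
    rw [e₁, e₂, Real.sin_add, Real.sin_sub]
    ring

/-- For finite order `m` and `θ = π / m`, the bound `n ≤ m` keeps `nθ` in `[0, π]`, where the sine
is nonnegative. -/
theorem dihedralCoeff_nonneg {i j : B} (hij : i ≠ j) {n : ℕ} (hn : M i j ≠ 0 → n ≤ M i j) :
    0 ≤ dihedralCoeff (-R.form (R.simpleRoot i) (R.simpleRoot j)) n := by
  by_cases h0 : M i j = 0
  · exact dihedralCoeff_nonneg_of_one_le (by linarith [R.form_of_infinite i j hij h0]) n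
  · have h1 : M i j ≠ 1 := M.off_diagonal i j hij
    have h2 : (2 : ℝ) ≤ M i j := by exact_mod_cast (by omega : 2 ≤ M i j)
    have hn' : (n : ℝ) ≤ M i j := by exact_mod_cast hn h0
    rw [R.form_of_finite i j hij h0, neg_neg]
    set θ := Real.pi / M i j with hθ
    have hθ0 : 0 < θ := by positivity
    have hmθ : (M i j : ℝ) * θ = Real.pi := by rw [hθ]; field_simp
    have hsin : 0 < Real.sin θ := Real.sin_pos_of_pos_of_lt_pi hθ0 (by nlinarith)
    have hs : 0 ≤ Real.sin (n * θ) :=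
      Real.sin_nonneg_of_nonneg_of_le_pi (by positivity) (by nlinarith)
    rw [← dihedralCoeff_cos] at hs
    exact nonneg_of_mul_nonneg_left hs hsin

/-- The word ends in `j` and grows on the left. Each new letter changes only the coefficient of its
own simple root, by the recursion of `dihedralCoeff`. -/
theorem rep_wordProd_alternatingWord (i j : B) (k : ℕ) :
    R.rep cs (cs.wordProd (CoxeterSystem.alternatingWord i j k)) (R.simpleRoot i) =
      dihedralCoeff (-R.form (R.simpleRoot i) (R.simpleRoot j)) (k + 1) •
          R.simpleRoot (if Even k then i else j) +
        dihedralCoeff (-R.form (R.simpleRoot i) (R.simpleRoot j)) k •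
          R.simpleRoot (if Even k then j else i) := by
  induction k with
  | zero => simp [CoxeterSystem.alternatingWord, dihedralCoeff]
  | succ k ih =>
    rw [CoxeterSystem.alternatingWord_succ', cs.wordProd_cons, map_mul, LinearEquiv.mul_apply, ih,
      rep_simple, dihedralCoeff]
    by_cases hk : Even k
    · have hk' : ¬ Even (k + 1) := by rwa [Nat.even_add_one, not_not]
      simp only [hk, hk', if_true, if_false, simpleReflection_apply, map_add, map_smul,
        R.form_self, R.form_symm (R.simpleRoot j) (R.simpleRoot i)]
      module
    · have hk' : Even (k + 1) := by rwa [Nat.even_add_one]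
      simp only [hk, hk', if_true, if_false, simpleReflection_apply, map_add, map_smul,
        R.form_self]
      module

/-- With `j` a right descent of `w`, split off the longest alternating word in `i, j` ending in `j`,
so that `w = v * word` with lengths adding. Then `v` has neither right descent, the word sends `αᵢ`
to a nonnegative combination of `αᵢ` and `αⱼ`, and induction applies to the shorter `v`. -/
theorem isNonneg_rep_simpleRoot {w : W} {i : B} (h : cs.length w < cs.length (w * cs.simple i)) :
    R.IsNonneg (R.rep cs w (R.simpleRoot i)) := by
  classical
  induction hn : cs.length w using Nat.strong_induction_on generalizing w i with
  | _ n ih =>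
  by_cases hw : w = 1
  · subst hw
    simpa using R.isNonneg_simpleRoot i
  obtain ⟨j, hj⟩ := cs.exists_rightDescent_of_ne_one hw
  have hij : i ≠ j := by
    rintro rfl
    exact lt_asymm h hj
  let P : ℕ → Prop := fun k => ∃ v : W,
    w = v * cs.wordProd (CoxeterSystem.alternatingWord i j k) ∧ cs.length w = cs.length v + k
  have hP1 : P 1 := by
    refine ⟨w * cs.simple j, by simp [CoxeterSystem.alternatingWord], ?_⟩
    have := cs.isRightDescent_iff.1 hj
    omega
  have hPle : ∀ k, P k → k ≤ cs.length w := by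
    rintro k ⟨v, -, hv⟩
    omega
  obtain ⟨k, hk1, ⟨v, hwv, hlv⟩, hk'⟩ : ∃ k, 1 ≤ k ∧ P k ∧ ¬ P (k + 1) := by
    refine ⟨Nat.findGreatest P (cs.length w), Nat.le_findGreatest (hPle 1 hP1) hP1,
      Nat.findGreatest_spec (hPle 1 hP1) hP1, fun hP => ?_⟩
    have := Nat.le_findGreatest (hPle _ hP) hP
    omega
  have hword : ∀ a b : B, ∀ n,
      cs.length (cs.wordProd (CoxeterSystem.alternatingWord a b n)) ≤ n := fun a b n =>
    (cs.length_wordProd_le _).trans (CoxeterSystem.length_alternatingWord a b n).le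
  have hred : ∀ u : W, w = v * u → k ≤ cs.length u := fun u hu => by
    have := cs.length_mul_le v u
    rw [← hu] at this
    omega
  -- An alternating word longer than `M i j` is not reduced. One of length exactly `M i j` could be
  -- rewritten by the braid relation to end in `i`, making `i` a right descent of `w`.
  have hkM : M i j ≠ 0 → k + 1 ≤ M i j := by
    intro h0
    by_contra! hlt
    rcases (show M i j ≤ k by omega).lt_or_eq with hlt | heq
    · apply cs.not_isReduced_alternatingWord i j h0 hlt
      rw [CoxeterSystem.IsReduced, CoxeterSystem.length_alternatingWord]
      exact (hword i j k).antisymm (hred _ hwv)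
    · have hb := cs.wordProd_braidWord_eq i j
      rw [CoxeterSystem.braidWord, CoxeterSystem.braidWord, M.symmetric j i, heq] at hb
      obtain ⟨l, rfl⟩ : ∃ l, k = l + 1 := ⟨k - 1, by omega⟩
      rw [hb, CoxeterSystem.alternatingWord_succ, cs.wordProd_concat] at hwv
      have h₁ : w * cs.simple i = v * cs.wordProd (CoxeterSystem.alternatingWord i j l) := by
        rw [hwv]; simp [mul_assoc]
      have h₂ := cs.length_mul_le v (cs.wordProd (CoxeterSystem.alternatingWord i j l))
      have h₃ := hword i j l
      rw [h₁] at h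
      omega
  have hnext : cs.length v < cs.length (v * cs.simple (if Even k then j else i)) := by
    by_contra hlt
    apply hk'
    refine ⟨v * cs.simple (if Even k then j else i), ?_, ?_⟩
    · rw [CoxeterSystem.alternatingWord_succ', cs.wordProd_cons, mul_assoc,
        cs.simple_mul_simple_cancel_left]
      exact hwv
    · rcases cs.length_mul_simple v (if Even k then j else i) with h' | h' <;> omega
  -- This letter is the first one of the word; if it shortened `v`, absorbing it into `v` would make
  -- `w` too short.
  have hfirst : cs.length v < cs.length (v * cs.simple (if Even k then i else j)) := by
    by_contra hlt
    obtain ⟨l, rfl⟩ : ∃ l, k = l + 1 := ⟨k - 1, by omega⟩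
    rw [CoxeterSystem.alternatingWord_succ', cs.wordProd_cons, ← mul_assoc] at hwv
    have e : (if Even (l + 1) then i else j) = (if Even l then j else i) := by
      by_cases hl : Even l <;> simp [hl, Nat.even_add_one]
    rw [e] at hlt
    have h₂ := cs.length_mul_le (v * cs.simple (if Even l then j else i))
      (cs.wordProd (CoxeterSystem.alternatingWord i j l))
    have h₃ := hword i j l
    rw [← hwv] at h₂
    rcases cs.length_mul_simple v (if Even l then j else i) with h' | h' <;> omega
  rw [hwv, map_mul, LinearEquiv.mul_apply, rep_wordProd_alternatingWord, map_add, map_smul,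
    map_smul]
  refine IsNonneg.add (IsNonneg.smul ?_ ?_) (IsNonneg.smul ?_ ?_)
  · exact ih (cs.length v) (by omega) hfirst rfl
  · exact R.dihedralCoeff_nonneg hij hkM
  · exact ih (cs.length v) (by omega) hnext rfl
  · exact R.dihedralCoeff_nonneg hij fun h0 => by have := hkM h0; omega

theorem isNonneg_neg_rep_simpleRoot {w : W} {i : B}
    (h : cs.length (w * cs.simple i) < cs.length w) :
    R.IsNonneg (-R.rep cs w (R.simpleRoot i)) := by
  have h' := R.isNonneg_rep_simpleRoot cs (w := w * cs.simple i) (i := i) (by simpa using h)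
  rwa [map_mul, LinearEquiv.mul_apply, rep_simple, simpleReflection_simpleRoot, map_neg] at h'

theorem isNonneg_rep_simpleRoot_iff {w : W} {i : B} :
    R.IsNonneg (R.rep cs w (R.simpleRoot i)) ↔ cs.length w < cs.length (w * cs.simple i) := by
  refine ⟨fun h => ?_, R.isNonneg_rep_simpleRoot cs⟩
  by_contra hlt
  have hne := cs.length_mul_simple_ne w i
  have := h.eq_zero_of_neg (R.isNonneg_neg_rep_simpleRoot cs (by omega))
  exact R.simpleRoot_ne_zero i ((R.rep cs w).map_eq_zero_iff.1 this)

theorem isNonneg_neg_rep_simpleRoot_iff {w : W} {i : B} :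
    R.IsNonneg (-R.rep cs w (R.simpleRoot i)) ↔ cs.length (w * cs.simple i) < cs.length w := by
  refine ⟨fun h => ?_, R.isNonneg_neg_rep_simpleRoot cs⟩
  by_contra hlt
  have hne := cs.length_mul_simple_ne w i
  have := (R.isNonneg_rep_simpleRoot cs (w := w) (i := i) (by omega)).eq_zero_of_neg h
  exact R.simpleRoot_ne_zero i ((R.rep cs w).map_eq_zero_iff.1 this)

end Positivity

end BasedRootSystem

namespace BasedRootSystem

/-! ### Inversion sets and additivity of length. -/

section Inversions

variable {B : Type*} {M : CoxeterMatrix B} {V : Type*} [AddCommGroup V] [Module ℝ V]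
  (R : BasedRootSystem M V) {W : Type*} [Group W] (cs : CoxeterSystem M W)

theorem rep_mem_roots {β : V} (hβ : β ∈ R.roots cs) (g : W) : R.rep cs g β ∈ R.roots cs := by
  obtain ⟨w, i, rfl⟩ := hβ
  exact ⟨g * w, i, by rw [map_mul, LinearEquiv.mul_apply]⟩

theorem neg_mem_roots {β : V} (hβ : β ∈ R.roots cs) : -β ∈ R.roots cs := by
  obtain ⟨w, i, rfl⟩ := hβ
  refine ⟨w * cs.simple i, i, ?_⟩
  rw [map_mul, LinearEquiv.mul_apply, rep_simple, simpleReflection_simpleRoot, map_neg]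

theorem isNonneg_or_isNonneg_neg {β : V} (hβ : β ∈ R.roots cs) :
    R.IsNonneg β ∨ R.IsNonneg (-β) := by
  obtain ⟨w, i, rfl⟩ := hβ
  rcases lt_or_gt_of_ne (cs.length_mul_simple_ne w i) with h | h
  · exact Or.inr (R.isNonneg_neg_rep_simpleRoot cs h)
  · exact Or.inl (R.isNonneg_rep_simpleRoot cs h)

theorem form_self_of_mem_roots {β : V} (hβ : β ∈ R.roots cs) : R.form β β = 1 := by
  obtain ⟨w, i, rfl⟩ := hβ
  rw [form_rep, form_self]

theorem mem_inversionRoots {β : V} {z : W} :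
    β ∈ R.inversionRoots cs z ↔
      β ∈ R.roots cs ∧ R.IsNonneg β ∧ R.IsNonneg (-R.rep cs z⁻¹ β) := by
  have hinv : ∀ γ, R.rep cs z⁻¹ (R.rep cs z γ) = γ := fun γ => by
    rw [← LinearEquiv.mul_apply, ← map_mul, inv_mul_cancel, map_one, LinearEquiv.coe_one, id]
  constructor
  · rintro ⟨⟨hβ, hn⟩, γ, ⟨-, hγ⟩, rfl⟩
    exact ⟨hβ, hn, by rwa [hinv]⟩
  · rintro ⟨hβ, hn, hz⟩
    refine ⟨⟨hβ, hn⟩, R.rep cs z⁻¹ β, ⟨?_, hz⟩, ?_⟩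
    · exact R.neg_mem_roots cs (R.rep_mem_roots cs hβ _)
    · rw [← LinearEquiv.mul_apply, ← map_mul, mul_inv_cancel, map_one, LinearEquiv.coe_one, id]

/-- The simple root `αᵢ` is the only positive root made negative by the reflection in `αᵢ`. -/
theorem eq_simpleRoot_of_isNonneg_neg {β : V} (hβ : β ∈ R.roots cs) (hn : R.IsNonneg β) {i : B}
    (hi : R.IsNonneg (-R.simpleReflection i β)) : β = R.simpleRoot i := by
  classical
  have hβ1 := R.form_self_of_mem_roots cs hβ
  obtain ⟨c, hc, hcβ⟩ := hn
  obtain ⟨d, hd, hdβ⟩ := hi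
  change β = Finsupp.linearCombination ℝ R.simpleRoot c at hcβ
  change _ = Finsupp.linearCombination ℝ R.simpleRoot d at hdβ
  rw [simpleReflection_apply] at hdβ
  set k := 2 * R.form (R.simpleRoot i) β
  -- Coefficients cannot be compared directly, as the simple roots may be linearly dependent. The
  -- terms off `i` are isolated in `f`; pairing with `αᵢ` shows that their sum is a nonpositive
  -- multiple of `αᵢ`, so positive independence forces `f = 0`.
  have hsum : Finsupp.linearCombination ℝ R.simpleRoot (c + d) = k • R.simpleRoot i := by
    rw [map_add, ← hcβ, ← hdβ]
    module
  set f : B →₀ ℝ := Finsupp.erase i (c + d) with hf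
  have hf0 : ∀ j, 0 ≤ f j := fun j => by
    rw [hf, Finsupp.erase_apply]
    split_ifs
    · exact le_rfl
    · exact add_nonneg (hc j) (hd j)
  have hsplit : Finsupp.linearCombination ℝ R.simpleRoot f =
      (k - (c + d) i) • R.simpleRoot i := by
    have := Finsupp.single_add_erase i (c + d)
    rw [← this, map_add, Finsupp.linearCombination_single] at hsum
    rw [sub_smul, ← hsum]
    abel
  have hle : k - (c + d) i ≤ 0 := by
    have h := congrArg (R.form (R.simpleRoot i)) hsplit
    rw [map_smul, form_self, smul_eq_mul, mul_one, Finsupp.linearCombination_apply, Finsupp.sum,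
      map_sum] at h
    rw [← h]
    refine Finset.sum_nonpos fun j _ => ?_
    rw [map_smul, smul_eq_mul]
    by_cases hij : i = j
    · subst hij
      simp [hf]
    · exact mul_nonpos_of_nonneg_of_nonpos (hf0 j) (R.form_nonpos hij)
  have hzero : f + Finsupp.single i ((c + d) i - k) = 0 := by
    refine R.pos_indep _ (fun j => add_nonneg (hf0 j) ?_) ?_
    · rw [Finsupp.single_apply]
      split_ifs
      · linarith
      · exact le_rfl
    · change Finsupp.linearCombination ℝ R.simpleRoot _ = 0
      rw [map_add, hsplit, Finsupp.linearCombination_single]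
      module
  have hcj : ∀ j, j ≠ i → c j = 0 := fun j hj => by
    have h := DFunLike.congr_fun hzero j
    rw [Finsupp.add_apply, Finsupp.single_eq_of_ne hj, hf, Finsupp.erase_ne hj, add_zero,
      Finsupp.add_apply, Finsupp.zero_apply] at h
    linarith [hc j, hd j]
  have hcs : c = Finsupp.single i (c i) := by
    ext j
    by_cases hj : j = i
    · subst hj
      simp
    · rw [hcj j hj, Finsupp.single_eq_of_ne hj]
  rw [hcs, Finsupp.linearCombination_single] at hcβ
  rw [hcβ] at hβ1
  simp only [map_smul, LinearMap.smul_apply, form_self, smul_eq_mul, mul_one] at hβ1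
  -- Roots have norm one, so the only positive multiple of `αᵢ` that can occur is `αᵢ` itself.
  have hci : c i = 1 := by nlinarith [hc i]
  rw [hcβ, hci, one_smul]

theorem exists_simple_mul_of_ne_one {u : W} (hu : u ≠ 1) :
    ∃ (i : B) (v : W), u = cs.simple i * v ∧ cs.length u = cs.length v + 1 := by
  obtain ⟨i, hi⟩ := cs.exists_leftDescent_of_ne_one hu
  exact ⟨i, cs.simple i * u, by simp, (cs.isLeftDescent_iff.1 hi).symm⟩

theorem rep_inv_simple_mul (i : B) (v : W) (β : V) :
    R.rep cs (cs.simple i * v)⁻¹ β = R.rep cs v⁻¹ (R.simpleReflection i β) := by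
  rw [mul_inv_rev, cs.inv_simple, map_mul, LinearEquiv.mul_apply, rep_simple]

/-- Write `u = sᵢ v`. If `sᵢ β` is still positive, it is a common inversion for the pair `x sᵢ`,
`v`. Otherwise `β = αᵢ`, so `i` is a right descent of `x` and a letter cancels in `x u`. -/
theorem length_lt_of_mem_inversionRoots {x u : W} {β : V} (hu : β ∈ R.inversionRoots cs u)
    (hx : β ∈ R.inversionRoots cs x⁻¹) : cs.length (x * u) < cs.length x + cs.length u := by
  rw [mem_inversionRoots] at hu hx
  rw [inv_inv] at hx
  induction hn : cs.length u generalizing u x β with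
  | zero =>
    rw [cs.length_eq_zero_iff] at hn
    subst hn
    have h0 := hu.2.1.eq_zero_of_neg (by simpa using hu.2.2)
    have := R.form_self_of_mem_roots cs hu.1
    simp [h0] at this
  | succ n ih =>
    obtain ⟨i, v, rfl, hv⟩ := exists_simple_mul_of_ne_one cs (u := u) (by
      rintro rfl
      simp at hn)
    obtain ⟨hβ, hβ0, hu⟩ := hu
    obtain ⟨-, -, hx⟩ := hx
    rw [rep_inv_simple_mul] at hu
    have hvn : cs.length v = n := by omega
    have hβ' : R.simpleReflection i β ∈ R.roots cs := by
      rw [← R.rep_simple cs]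
      exact R.rep_mem_roots cs hβ _
    rw [← mul_assoc]
    rcases R.isNonneg_or_isNonneg_neg cs hβ' with h | h
    · have hxs : R.rep cs (x * cs.simple i) (R.simpleReflection i β) = R.rep cs x β := by
        rw [← R.rep_simple cs, ← LinearEquiv.mul_apply, ← map_mul,
          cs.simple_mul_simple_cancel_right]
      have := ih (x := x * cs.simple i) ⟨hβ', h, hu⟩ ⟨hβ', h, by rwa [hxs]⟩ hvn
      have := cs.length_mul_le x (cs.simple i)
      rw [cs.length_simple] at this
      omega
    · rw [R.eq_simpleRoot_of_isNonneg_neg cs hβ hβ0 h, isNonneg_neg_rep_simpleRoot_iff] at hx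
      have := cs.length_mul_le (x * cs.simple i) v
      omega

/-- Write `u = sᵢ v`. If `x sᵢ` is shorter than `x`, the root `αᵢ` serves. Otherwise the pair `x
sᵢ`, `v` is still not additive, and `sᵢ` carries its common inversion back. -/
theorem exists_mem_inversionRoots {x u : W} (h : cs.length (x * u) < cs.length x + cs.length u) :
    ∃ β, β ∈ R.inversionRoots cs u ∧ β ∈ R.inversionRoots cs x⁻¹ := by
  simp only [mem_inversionRoots, inv_inv]
  induction hn : cs.length u generalizing u x with
  | zero =>
    rw [cs.length_eq_zero_iff] at hn
    subst hn
    simp at h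
  | succ n ih =>
    obtain ⟨i, v, rfl, hv⟩ := exists_simple_mul_of_ne_one cs (u := u) (by
      rintro rfl
      simp at hn)
    have hvn : cs.length v = n := by omega
    have hroot : R.simpleRoot i ∈ R.roots cs := ⟨1, i, by simp⟩
    have hvi : R.IsNonneg (R.rep cs v⁻¹ (R.simpleRoot i)) := by
      rw [isNonneg_rep_simpleRoot_iff, ← cs.length_inv (v⁻¹ * _), mul_inv_rev, inv_inv,
        cs.inv_simple, cs.length_inv]
      omega
    rcases lt_or_gt_of_ne (cs.length_mul_simple_ne x i) with hlt | hgt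
    · refine ⟨R.simpleRoot i, ⟨hroot, R.isNonneg_simpleRoot i, ?_⟩, hroot,
        R.isNonneg_simpleRoot i, R.isNonneg_neg_rep_simpleRoot cs hlt⟩
      rwa [rep_inv_simple_mul, simpleReflection_simpleRoot, map_neg, neg_neg]
    · rw [← mul_assoc] at h
      obtain ⟨β, ⟨hβ, hβ0, hβv⟩, -, -, hβx⟩ := ih (x := x * cs.simple i) (u := v) (by omega) hvn
      have hβ' : R.simpleReflection i β ∈ R.roots cs := by
        rw [← R.rep_simple cs]
        exact R.rep_mem_roots cs hβ _
      -- Were it negative, `β` would be `αᵢ`, but `v⁻¹` keeps `αᵢ` positive.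
      have hnn : R.IsNonneg (R.simpleReflection i β) := by
        refine (R.isNonneg_or_isNonneg_neg cs hβ').resolve_right fun h' => ?_
        rw [R.eq_simpleRoot_of_isNonneg_neg cs hβ hβ0 h'] at hβv
        exact R.simpleRoot_ne_zero i ((R.rep cs v⁻¹).map_eq_zero_iff.1 (hvi.eq_zero_of_neg hβv))
      rw [map_mul, LinearEquiv.mul_apply, rep_simple] at hβx
      refine ⟨R.simpleReflection i β, ⟨hβ', hnn, ?_⟩, hβ', hnn, hβx⟩
      have hinv : R.simpleReflection i (R.simpleReflection i β) = β := by
        rw [← R.rep_simple cs, ← LinearEquiv.mul_apply, ← map_mul, cs.simple_mul_simple_self,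
          map_one, LinearEquiv.coe_one, id]
      rw [rep_inv_simple_mul, hinv]
      exact hβv

theorem length_mul_eq_add_iff (x u : W) :
    cs.length (x * u) = cs.length x + cs.length u ↔
      R.inversionRoots cs u ∩ R.inversionRoots cs x⁻¹ = ∅ := by
  rw [Set.eq_empty_iff_forall_notMem]
  constructor
  · rintro h β ⟨hu, hx⟩
    exact (R.length_lt_of_mem_inversionRoots cs hu hx).ne h
  · intro h
    by_contra hne
    obtain ⟨β, hu, hx⟩ := R.exists_mem_inversionRoots cs
      (lt_of_le_of_ne (cs.length_mul_le x u) hne)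
    exact h β ⟨hu, hx⟩

end Inversions

end BasedRootSystem

namespace BasedRootSystem

/-! ### The standard geometric representation, with coordinatewise signs. -/

section Standard

variable {B : Type*} (M : CoxeterMatrix B)

open Classical in
/-- The inner products of the simple roots in the standard geometric representation. -/
noncomputable def standardGram (i j : B) : ℝ :=
  if M i j = 0 then -1 else -Real.cos (Real.pi / (M i j : ℝ))

/-- The root system of the standard geometric representation, whose simple roots form a basis. -/
noncomputable def standard : BasedRootSystem M (B →₀ ℝ) where
  form := Finsupp.linearCombination ℝ fun i => Finsupp.linearCombination ℝ (standardGram M i)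
  simpleRoot i := Finsupp.single i 1
  form_symm := by
    intro v w
    induction v using Finsupp.induction_linear with
    | zero => simp
    | add v v' h h' => simp only [map_add, LinearMap.add_apply, h, h']
    | single i a =>
      induction w using Finsupp.induction_linear with
      | zero => simp
      | add v v' h h' => simp only [map_add, LinearMap.add_apply, h, h']
      | single j b =>
        simp only [Finsupp.linearCombination_single, LinearMap.smul_apply, smul_eq_mul,
          standardGram, M.symmetric j i]
        ring
  form_self i := by simp [standardGram]
  form_of_finite i j _ h := by simp [standardGram, h]
  form_of_infinite i j _ h := by simp [standardGram, h]
  pos_indep c _ h := by simpa using h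

theorem standard_simpleRoot (i : B) : (standard M).simpleRoot i = Finsupp.single i 1 := rfl

variable {M}

theorem standard_isNonneg_iff {v : B →₀ ℝ} : (standard M).IsNonneg v ↔ ∀ i, 0 ≤ v i := by
  constructor
  · rintro ⟨c, hc, rfl⟩
    simpa [standard_simpleRoot] using hc
  · intro h
    exact ⟨v, h, by simp [standard_simpleRoot]⟩

theorem standard_simpleReflection_apply_of_ne {i j : B} (h : j ≠ i) (v : B →₀ ℝ) :
    (standard M).simpleReflection i v j = v j := by
  rw [simpleReflection_apply, standard_simpleRoot, Finsupp.sub_apply, Finsupp.smul_apply,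
    Finsupp.single_eq_of_ne h, smul_zero, sub_zero]

variable {W : Type*} [Group W] (cs : CoxeterSystem M W)

theorem standard_rep_apply_of_mem_closure {a b j : B} (ha : j ≠ a) (hb : j ≠ b) {w : W}
    (hw : w ∈ Subgroup.closure {cs.simple a, cs.simple b}) (v : B →₀ ℝ) :
    (standard M).rep cs w v j = v j := by
  induction hw using Subgroup.closure_induction generalizing v with
  | mem x hx =>
    rcases hx with rfl | rfl
    · rw [rep_simple, standard_simpleReflection_apply_of_ne ha]
    · rw [rep_simple, standard_simpleReflection_apply_of_ne hb]
  | one => simp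
  | mul x y _ _ hx hy => rw [map_mul, LinearEquiv.mul_apply, hx, hy]
  | inv x _ hx =>
    have := hx ((standard M).rep cs x⁻¹ v)
    rw [← this, ← LinearEquiv.mul_apply, ← map_mul, mul_inv_cancel, map_one, LinearEquiv.coe_one,
      id]

end Standard

end BasedRootSystem

namespace CoxeterSystem

/-! ### Left descents and joins in the weak order. -/

section Joins

open BasedRootSystem

variable {B : Type*} {W : Type*} [Group W] {M : CoxeterMatrix B} (cs : CoxeterSystem M W)

theorem weakOrder_le_iff {x y : W} :
    cs.weakOrder.le x y ↔ cs.length y = cs.length x + cs.length (x⁻¹ * y) := Iff.rfl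

theorem length_mul_inv_mul_le (x y : W) : cs.length y ≤ cs.length x + cs.length (x⁻¹ * y) := by
  simpa using cs.length_mul_le x (x⁻¹ * y)

theorem length_inv_mul_simple (w : W) (i : B) :
    cs.length (w⁻¹ * cs.simple i) = cs.length (cs.simple i * w) := by
  rw [← cs.length_inv, mul_inv_rev, inv_inv, cs.inv_simple]

theorem standard_isNonneg_rep_inv_iff {w : W} {i : B} :
    (∀ j, 0 ≤ (standard M).rep cs w⁻¹ (Finsupp.single i 1) j) ↔
      cs.length w < cs.length (cs.simple i * w) := by
  rw [← standard_isNonneg_iff (M := M), ← standard_simpleRoot M, isNonneg_rep_simpleRoot_iff,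
    length_inv_mul_simple, length_inv]

theorem standard_isNonneg_neg_rep_inv {w : W} {i : B}
    (h : cs.length (cs.simple i * w) < cs.length w) (j : B) :
    (standard M).rep cs w⁻¹ (Finsupp.single i 1) j ≤ 0 := by
  have h' := (standard M).isNonneg_neg_rep_simpleRoot cs (w := w⁻¹) (i := i)
    (by rwa [length_inv_mul_simple, length_inv])
  rw [standard_simpleRoot] at h'
  simpa using standard_isNonneg_iff.1 h' j

/-- A maximal left factor of `y` in the subgroup generated by two simple reflections. -/
theorem exists_dihedral_factor (a b : B) (y : W) :
    ∃ w ∈ Subgroup.closure {cs.simple a, cs.simple b},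
      cs.length y = cs.length w + cs.length (w⁻¹ * y) ∧
        ∀ c ∈ ({a, b} : Set B),
          cs.length (w⁻¹ * y) < cs.length (cs.simple c * (w⁻¹ * y)) := by
  classical
  set H := Subgroup.closure {cs.simple a, cs.simple b}
  let P : ℕ → Prop := fun k => ∃ w ∈ H, cs.length w = k ∧
    cs.length y = cs.length w + cs.length (w⁻¹ * y)
  have hP0 : P 0 := ⟨1, H.one_mem, by simp, by simp⟩
  obtain ⟨w, hw, hwk, hwy⟩ := Nat.findGreatest_spec (Nat.zero_le (cs.length y)) hP0
  refine ⟨w, hw, hwy, fun c hc => ?_⟩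
  -- A left descent `c` of the remaining factor could be moved into `w`, against the maximality of
  -- its length.
  by_contra hlt
  have hc' : cs.simple c ∈ H := Subgroup.subset_closure (by
    rcases hc with rfl | rfl
    · exact Or.inl rfl
    · exact Or.inr rfl)
  have h₁ : cs.length (cs.simple c * (w⁻¹ * y)) + 1 = cs.length (w⁻¹ * y) := by
    rcases cs.length_simple_mul (w⁻¹ * y) c with h | h <;> omega
  have e : (w * cs.simple c)⁻¹ * y = cs.simple c * (w⁻¹ * y) := by
    rw [mul_inv_rev, cs.inv_simple, mul_assoc]
  have h₂ := cs.length_mul_inv_mul_le (w * cs.simple c) y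
  rw [e] at h₂
  have h₃ : cs.length (w * cs.simple c) = cs.length w + 1 := by
    rcases cs.length_mul_simple w c with h | h <;> omega
  have hP : P (cs.length w + 1) :=
    ⟨w * cs.simple c, H.mul_mem hw hc', h₃, by rw [e]; omega⟩
  have := Nat.le_findGreatest (P := P) (n := cs.length y) (by omega) hP
  omega

/-- Two covers `p sₐ` and `p s_b` of `p` with a common upper bound have a join; a simple
reflection which is not a left descent of either is not a left descent of the join. -/
theorem exists_join_of_covers {p y : W} {a b i : B} (hab : a ≠ b)
    (ha : cs.length (p * cs.simple a) = cs.length p + 1)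
    (hb : cs.length (p * cs.simple b) = cs.length p + 1)
    (hay : cs.weakOrder.le (p * cs.simple a) y) (hby : cs.weakOrder.le (p * cs.simple b) y)
    (hi : cs.length p < cs.length (cs.simple i * p))
    (hia : cs.length (p * cs.simple a) < cs.length (cs.simple i * (p * cs.simple a)))
    (hib : cs.length (p * cs.simple b) < cs.length (cs.simple i * (p * cs.simple b))) :
    ∃ q, cs.weakOrder.le (p * cs.simple a) q ∧ cs.weakOrder.le (p * cs.simple b) q ∧
      cs.weakOrder.le q y ∧ cs.length q < cs.length (cs.simple i * q) := by
  obtain ⟨w, hw, hwy, hg⟩ := cs.exists_dihedral_factor a b (p⁻¹ * y)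
  set g := w⁻¹ * (p⁻¹ * y) with hgdef
  have hw' := Subgroup.inv_mem _ hw
  have hinv : ∀ c, (p * cs.simple c)⁻¹ * y = cs.simple c * (p⁻¹ * y) := fun c => by
    rw [mul_inv_rev, cs.inv_simple, mul_assoc]
  rw [weakOrder_le_iff, hinv] at hay hby
  have hy := cs.length_mul_inv_mul_le p y
  have hdesc : ∀ c ∈ ({a, b} : Set B),
      cs.length (cs.simple c * (p⁻¹ * y)) + 1 = cs.length (p⁻¹ * y) := by
    rintro c (rfl | rfl)
    · rcases cs.length_simple_mul (p⁻¹ * y) c with h | h <;> omega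
    · rcases cs.length_simple_mul (p⁻¹ * y) c with h | h <;> omega
  have hdecomp : ∀ v : B →₀ ℝ, (∀ j, j ≠ a → j ≠ b → v j = 0) →
      v = v a • Finsupp.single a 1 + v b • Finsupp.single b 1 := by
    intro v hv
    ext j
    by_cases hja : j = a
    · subst hja
      simp [Finsupp.single_eq_of_ne hab]
    · by_cases hjb : j = b
      · subst hjb
        simp [Finsupp.single_eq_of_ne hja]
      · simp [hv j hja hjb, Finsupp.single_eq_of_ne hja, Finsupp.single_eq_of_ne hjb]
  -- Otherwise `w⁻¹ α_c` is a nonnegative combination of `α_a` and `α_b`, both kept nonnegative by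
  -- `g⁻¹`. Then `c` would not be a left descent of `p⁻¹ y = w g`.
  have hwc : ∀ c ∈ ({a, b} : Set B), cs.length (cs.simple c * w) + 1 = cs.length w := by
    intro c hc
    have hnot : ¬ cs.length w < cs.length (cs.simple c * w) := by
      intro hlt
      rw [← standard_isNonneg_rep_inv_iff] at hlt
      set v := (standard M).rep cs w⁻¹ (Finsupp.single c 1) with hv
      have hv0 := hdecomp v fun j hja hjb => by
        have hjc : j ≠ c := by
          rcases hc with rfl | rfl
          · exact hja
          · exact hjb
        rw [hv, standard_rep_apply_of_mem_closure cs hja hjb hw', Finsupp.single_eq_of_ne hjc]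
      have hlt' : cs.length (p⁻¹ * y) < cs.length (cs.simple c * (p⁻¹ * y)) := by
        rw [← standard_isNonneg_rep_inv_iff]
        intro j
        have e : (p⁻¹ * y)⁻¹ = g⁻¹ * w⁻¹ := by rw [hgdef]; group
        rw [e, map_mul, LinearEquiv.mul_apply, ← hv, hv0, map_add, map_smul, map_smul]
        have h₁ := (cs.standard_isNonneg_rep_inv_iff.2 (hg a (Or.inl rfl))) j
        have h₂ := (cs.standard_isNonneg_rep_inv_iff.2 (hg b (Or.inr rfl))) j
        exact add_nonneg (mul_nonneg (hlt a) h₁) (mul_nonneg (hlt b) h₂)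
      have := hdesc c hc
      omega
    rcases cs.length_simple_mul w c with h | h <;> omega
  have hpwg : (p * w)⁻¹ * y = g := by rw [hgdef]; group
  have hle := cs.length_mul_inv_mul_le (p * w) y
  rw [hpwg] at hle
  have hd := hdesc a (Or.inl rfl)
  have hpw : cs.length (p * w) = cs.length p + cs.length w := by
    have := cs.length_mul_le p w
    omega
  have hcw : ∀ c, (p * cs.simple c)⁻¹ * (p * w) = cs.simple c * w := fun c => by
    rw [mul_inv_rev, cs.inv_simple]; group
  refine ⟨p * w, ?_, ?_, ?_, ?_⟩
  · have := hwc a (Or.inl rfl)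
    rw [weakOrder_le_iff, hcw]
    omega
  · have := hwc b (Or.inr rfl)
    rw [weakOrder_le_iff, hcw]
    omega
  · rw [weakOrder_le_iff, hpwg]
    omega
  -- If `i` is a left descent of `p w`, then `γ = p⁻¹ αᵢ` is nonnegative while `w⁻¹ γ` is
  -- nonpositive. As `w⁻¹` preserves coordinates off `a, b`, the vector `γ` lies in the span of
  -- `α_a` and `α_b`.
  by_contra hlt
  have hlt' : cs.length (cs.simple i * (p * w)) < cs.length (p * w) :=
    lt_of_le_of_ne (not_lt.1 hlt) (cs.length_simple_mul_ne _ _)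
  have hneg := cs.standard_isNonneg_neg_rep_inv hlt'
  rw [← standard_isNonneg_rep_inv_iff] at hi hia hib
  simp only [mul_inv_rev, map_mul, LinearEquiv.mul_apply, cs.inv_simple, rep_simple]
    at hneg hia hib
  set γ := (standard M).rep cs p⁻¹ (Finsupp.single i 1) with hγ
  have hγp : (standard M).rep cs p γ = Finsupp.single i 1 := by
    rw [hγ, ← LinearEquiv.mul_apply, ← map_mul, mul_inv_cancel, map_one, LinearEquiv.coe_one, id]
  have hγ0 : γ ≠ 0 := fun h => by
    rw [h, map_zero] at hγp
    exact one_ne_zero (Finsupp.single_eq_zero.1 hγp.symm)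
  have hγab := hdecomp γ fun j hja hjb => by
    have h₁ := hneg j
    rw [standard_rep_apply_of_mem_closure cs hja hjb hw'] at h₁
    exact h₁.antisymm (hi j)
  -- A multiple of `α_c` is negated by `s_c`, so it cannot stay nonnegative unless it vanishes.
  -- Hence both coordinates of `γ` are positive.
  have hne : ∀ c, (∀ j, 0 ≤ (standard M).simpleReflection c γ j) →
      γ ≠ γ c • Finsupp.single c 1 := by
    intro c hc h
    have h₁ := hc c
    rw [h, map_smul, ← standard_simpleRoot M, simpleReflection_simpleRoot, standard_simpleRoot] at h₁
    simp only [Finsupp.smul_apply, Finsupp.neg_apply, Finsupp.single_eq_same, smul_eq_mul] at h₁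
    have h₂ : γ c = 0 := by linarith [hi c]
    rw [h₂, zero_smul] at h
    exact hγ0 h
  have hγa : 0 < γ a := lt_of_le_of_ne (hi a) fun h => hne b hib (by
    rw [← h, zero_smul, zero_add] at hγab
    exact hγab)
  have hγb : 0 < γ b := lt_of_le_of_ne (hi b) fun h => hne a hia (by
    rw [← h, zero_smul, add_zero] at hγab
    exact hγab)
  have hpos : ∀ c, cs.length (p * cs.simple c) = cs.length p + 1 →
      ∀ j, 0 ≤ (standard M).rep cs p (Finsupp.single c 1) j := fun c hc => by
    rw [← standard_simpleRoot M, ← standard_isNonneg_iff (M := M), isNonneg_rep_simpleRoot_iff]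
    omega
  have hsum : γ a • (standard M).rep cs p (Finsupp.single a 1) +
      γ b • (standard M).rep cs p (Finsupp.single b 1) = Finsupp.single i 1 := by
    rw [← map_smul, ← map_smul, ← map_add, ← hγab, hγp]
  -- A sum of nonnegative vectors with positive weights equals `αᵢ`, so `p α_a` and `p α_b` are both
  -- multiples of `αᵢ`, against their linear independence.
  have hcoord : ∀ j, j ≠ i → (standard M).rep cs p (Finsupp.single a 1) j = 0 ∧
      (standard M).rep cs p (Finsupp.single b 1) j = 0 := by
    intro j hj
    have h := DFunLike.congr_fun hsum j
    rw [Finsupp.single_eq_of_ne hj, Finsupp.add_apply, Finsupp.smul_apply, Finsupp.smul_apply,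
      smul_eq_mul, smul_eq_mul] at h
    have h₁ := mul_nonneg hγa.le (hpos a ha j)
    have h₂ := mul_nonneg hγb.le (hpos b hb j)
    exact ⟨(mul_eq_zero.1 (by linarith)).resolve_left hγa.ne',
      (mul_eq_zero.1 (by linarith)).resolve_left hγb.ne'⟩
  set l := (standard M).rep cs p (Finsupp.single a 1) i with hl
  set m := (standard M).rep cs p (Finsupp.single b 1) i with hm
  have heq : m • (standard M).rep cs p (Finsupp.single a 1) =
      l • (standard M).rep cs p (Finsupp.single b 1) := by
    ext j
    by_cases hj : j = i
    · subst hj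
      simp only [Finsupp.smul_apply, smul_eq_mul, ← hl, ← hm]
      ring
    · simp [hcoord j hj]
  rw [← map_smul, ← map_smul] at heq
  have heq' := (LinearEquiv.injective _) heq
  have hm0 : m = 0 := by
    have := DFunLike.congr_fun heq' a
    simpa [Finsupp.single_eq_of_ne hab] using this
  have hzero : (standard M).rep cs p (Finsupp.single b 1) = 0 := by
    ext j
    by_cases hj : j = i
    · subst hj
      rw [← hm, hm0, Finsupp.zero_apply]
    · exact (hcoord j hj).2
  rw [LinearEquiv.map_eq_zero_iff] at hzero
  simp at hzero

theorem length_lt_simple_mul_of_le {u v : W} {i : B} (h : cs.weakOrder.le u v)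
    (hv : cs.length v < cs.length (cs.simple i * v)) :
    cs.length u < cs.length (cs.simple i * u) := by
  rw [weakOrder_le_iff] at h
  have h₁ := cs.length_mul_le (cs.simple i * u) (u⁻¹ * v)
  rw [show cs.simple i * u * (u⁻¹ * v) = cs.simple i * v by group] at h₁
  omega

theorem exists_cover_le {p u : W} (h : cs.weakOrder.le p u) (hne : p ≠ u) :
    ∃ a, cs.length (p * cs.simple a) = cs.length p + 1 ∧ cs.weakOrder.le p (p * cs.simple a) ∧
      cs.weakOrder.le (p * cs.simple a) u := by
  rw [weakOrder_le_iff] at h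
  obtain ⟨a, ha⟩ := cs.exists_leftDescent_of_ne_one (w := p⁻¹ * u) fun h1 =>
    hne (inv_mul_eq_one.1 h1)
  have ha' := cs.isLeftDescent_iff.1 ha
  have e : (p * cs.simple a)⁻¹ * u = cs.simple a * (p⁻¹ * u) := by
    rw [mul_inv_rev, cs.inv_simple, mul_assoc]
  have h₁ := cs.length_mul_inv_mul_le (p * cs.simple a) u
  rw [e] at h₁
  have h₂ : cs.length (p * cs.simple a) = cs.length p + 1 := by
    rcases cs.length_mul_simple p a with h' | h' <;> omega
  refine ⟨a, h₂, ?_, ?_⟩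
  · rw [weakOrder_le_iff, inv_mul_cancel_left, cs.length_simple, h₂]
  · rw [weakOrder_le_iff, e]
    omega

/-- In a principal lower set, the elements without the left descent `i` are directed. -/
theorem exists_upper_bound_of_not_descent {y p u v : W} {i : B} (hpu : cs.weakOrder.le p u)
    (hpv : cs.weakOrder.le p v) (huy : cs.weakOrder.le u y) (hvy : cs.weakOrder.le v y)
    (hu : cs.length u < cs.length (cs.simple i * u))
    (hv : cs.length v < cs.length (cs.simple i * v)) :
    ∃ q, cs.weakOrder.le u q ∧ cs.weakOrder.le v q ∧ cs.weakOrder.le q y ∧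
      cs.length q < cs.length (cs.simple i * q) := by
  let _ : PartialOrder W := cs.weakOrder
  change p ≤ u at hpu
  change p ≤ v at hpv
  change u ≤ y at huy
  change v ≤ y at hvy
  change ∃ q, u ≤ q ∧ v ≤ q ∧ q ≤ y ∧ _
  induction hn : cs.length y - cs.length p using Nat.strong_induction_on
    generalizing p u v with
  | _ n ih =>
  by_cases hpu' : p = u
  · subst hpu'
    exact ⟨v, hpv, le_rfl, hvy, hv⟩
  by_cases hpv' : p = v
  · subst hpv'
    exact ⟨u, le_rfl, hpu, huy, hu⟩
  obtain ⟨a, ha, hpa, hau⟩ := cs.exists_cover_le hpu hpu'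
  obtain ⟨b, hb, hpb, hbv⟩ := cs.exists_cover_le hpv hpv'
  change p * cs.simple a ≤ u at hau
  change p * cs.simple b ≤ v at hbv
  have hlen : ∀ {r}, r ≤ y → cs.length r ≤ cs.length y := fun {r} h => by
    have := cs.weakOrder_le_iff.1 h
    omega
  have hay := hlen (hau.trans huy)
  have hby := hlen (hbv.trans hvy)
  by_cases hab : a = b
  · subst hab
    exact ih _ (by omega) hu hv hau hbv huy hvy rfl
  -- Diamond argument: `q` bounds the two covers, `r` bounds `u` and `q` above `p sₐ`, and `t`
  -- bounds `r` and `v` above `p s_b`. Both recursive calls start from a longer base point.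
  obtain ⟨q, haq, hbq, hqy, hq⟩ := cs.exists_join_of_covers hab ha hb (hau.trans huy)
    (hbv.trans hvy) (cs.length_lt_simple_mul_of_le hpu hu) (cs.length_lt_simple_mul_of_le hau hu)
    (cs.length_lt_simple_mul_of_le hbv hv)
  obtain ⟨r, hur, hqr, hry, hr⟩ := ih _ (by omega) hu hq hau haq huy hqy rfl
  obtain ⟨t, hrt, hvt, hty, ht⟩ := ih _ (by omega) hr hv (le_trans hbq hqr) hbv hry hvy rfl
  exact ⟨t, hur.trans hrt, hvt, hty, ht⟩

theorem weakOrder_one_le (u : W) : cs.weakOrder.le 1 u := by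
  simp [weakOrder_le_iff]

/-- A longest element `z` below `y` without left descent `i` lies above all of `U`, by directedness.
So it is an upper bound and equals the join. -/
theorem not_descent_of_isLUB {U : Set W} {y : W} {i : B}
    (hU : ∀ u ∈ U, cs.length u < cs.length (cs.simple i * u))
    (hy : @IsLUB W cs.weakOrder.toLE U y) : cs.length y < cs.length (cs.simple i * y) := by
  classical
  let _ : PartialOrder W := cs.weakOrder
  let P : ℕ → Prop := fun k => ∃ z, z ≤ y ∧ cs.length z < cs.length (cs.simple i * z) ∧
    cs.length z = k
  have hP0 : P 0 := ⟨1, cs.weakOrder_one_le y, by simp, by simp⟩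
  obtain ⟨z, hzy, hz, hzk⟩ := Nat.findGreatest_spec (Nat.zero_le (cs.length y)) hP0
  have hbound : y ≤ z := hy.2 fun u hu => by
    obtain ⟨q, huq, hzq, hqy, hq⟩ := cs.exists_upper_bound_of_not_descent
      (cs.weakOrder_one_le u) (cs.weakOrder_one_le z) (hy.1 hu) hzy (hU u hu) hz
    have h₁ := cs.weakOrder_le_iff.1 hqy
    have h₂ := Nat.le_findGreatest (P := P) (n := cs.length y) (by omega) ⟨q, hqy, hq, rfl⟩
    have h₃ := cs.weakOrder_le_iff.1 hzq
    have h₄ : z = q := inv_mul_eq_one.1 (cs.length_eq_zero_iff.1 (by omega))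
    rw [h₄]
    exact huq
  rwa [le_antisymm hbound hzy]

theorem mul_le_mul_iff_of_length {x u v : W}
    (hu : cs.length (x * u) = cs.length x + cs.length u)
    (hv : cs.length (x * v) = cs.length x + cs.length v) :
    cs.weakOrder.le (x * u) (x * v) ↔ cs.weakOrder.le u v := by
  rw [weakOrder_le_iff, weakOrder_le_iff, show (x * u)⁻¹ * (x * v) = u⁻¹ * v by group]
  omega

/-- Move a right descent `i` of `x` across: `sᵢ U` has join `sᵢ y`, and every element of `sᵢ U` is
length-additive with the shorter `x sᵢ`. -/
theorem length_mul_of_isLUB {x : W} {U : Set W} {y : W}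
    (hU : ∀ u ∈ U, cs.length (x * u) = cs.length x + cs.length u)
    (hy : @IsLUB W cs.weakOrder.toLE U y) :
    cs.length (x * y) = cs.length x + cs.length y := by
  let _ : PartialOrder W := cs.weakOrder
  induction hn : cs.length x generalizing x U y with
  | zero =>
    rw [cs.length_eq_zero_iff] at hn
    simp [hn]
  | succ n ih =>
    obtain ⟨i, hi⟩ := cs.exists_rightDescent_of_ne_one (w := x) (by
      rintro rfl
      simp at hn)
    have hi' := cs.isRightDescent_iff.1 hi
    -- The empty set is separate, because the join of its translate is `1` and not `sᵢ y`.
    rcases U.eq_empty_or_nonempty with rfl | ⟨u₀, hu₀⟩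
    · have hy1 : y = 1 :=
        le_antisymm (hy.2 fun _ h => h.elim) (cs.weakOrder_one_le y)
      simp [hy1, hn]
    have hfac : ∀ u, x * cs.simple i * (cs.simple i * u) = x * u := fun u => by
      rw [← mul_assoc, cs.simple_mul_simple_cancel_right]
    have hsu : ∀ u ∈ U, cs.length (cs.simple i * u) = cs.length u + 1 := fun u hu => by
      have h₁ := hU u hu
      have h₂ := cs.length_mul_le (x * cs.simple i) (cs.simple i * u)
      rw [hfac] at h₂
      rcases cs.length_simple_mul u i with h | h <;> omega
    have hsy : cs.length (cs.simple i * y) = cs.length y + 1 := by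
      have h := cs.not_descent_of_isLUB (i := i) (fun u hu => (by have := hsu u hu; omega)) hy
      rcases cs.length_simple_mul y i with h | h <;> omega
    have hadd : ∀ u, cs.length (cs.simple i * u) = cs.length u + 1 →
        cs.length (cs.simple i * u) = cs.length (cs.simple i) + cs.length u := fun u h => by
      rw [cs.length_simple, h, add_comm]
    have hlub : IsLUB ((cs.simple i * ·) '' U) (cs.simple i * y) := by
      constructor
      · rintro _ ⟨u, hu, rfl⟩
        exact (cs.mul_le_mul_iff_of_length (hadd u (hsu u hu)) (hadd y hsy)).2 (hy.1 hu)
      · intro z hz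
        have hz₀ := hz ⟨u₀, hu₀, rfl⟩
        -- An upper bound `z` of `sᵢ U` inherits the left descent `i` from `sᵢ u₀`, so it can be
        -- translated back by `sᵢ` and compared with `y`.
        have hsz : cs.length (cs.simple i * (cs.simple i * z)) =
            cs.length (cs.simple i * z) + 1 := by
          have hlt : ¬ cs.length z < cs.length (cs.simple i * z) := fun h => by
            have h₁ := cs.length_lt_simple_mul_of_le hz₀ h
            dsimp only at h₁
            rw [cs.simple_mul_simple_cancel_left] at h₁
            have := hsu u₀ hu₀
            omega
          rw [cs.simple_mul_simple_cancel_left]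
          rcases cs.length_simple_mul z i with h | h <;> omega
        rw [← cs.simple_mul_simple_cancel_left (w := z) i]
        refine (cs.mul_le_mul_iff_of_length (hadd y hsy) (hadd _ hsz)).2 (hy.2 fun u hu => ?_)
        refine (cs.mul_le_mul_iff_of_length (hadd u (hsu u hu)) (hadd _ hsz)).1 ?_
        rw [cs.simple_mul_simple_cancel_left]
        exact hz ⟨u, hu, rfl⟩
    have hxi : cs.length (x * cs.simple i) = n := by omega
    have h := ih (x := x * cs.simple i) (U := (cs.simple i * ·) '' U) (y := cs.simple i * y) (by
      rintro _ ⟨u, hu, rfl⟩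
      have h₁ := hU u hu
      have h₂ := hsu u hu
      dsimp only
      rw [hfac]
      omega) hlub hxi
    rw [hfac] at h
    omega

end Joins

end CoxeterSystem

theorem corollary1p6 {B : Type*} {W : Type*} [Group W] {M : CoxeterMatrix B}
    (cs : CoxeterSystem M W) (x : W) :
    letI : PartialOrder W := cs.weakOrder
    -- (a) left multiplication by `x` restricts to an isomorphism of subposets,
    -- whose domain is an order ideal and whose range is an order coideal
    (∃ e : {u : W | cs.length (x * u) = cs.length x + cs.length u} ≃o {z : W | x ≤ z},
        ∀ u, (e u : W) = x * (u : W)) ∧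
      IsLowerSet {u : W | cs.length (x * u) = cs.length x + cs.length u} ∧
      IsUpperSet {z : W | x ≤ z} ∧
      -- (b) the domain is closed under the joins that exist in `W`
      (∀ (U : Set W) (y : W),
        (∀ u ∈ U, cs.length (x * u) = cs.length x + cs.length u) → IsLUB U y →
          cs.length (x * y) = cs.length x + cs.length y) ∧
      -- the reformulation of the length condition through root systems
      (∀ {V : Type*} [AddCommGroup V] [Module ℝ V] (R : BasedRootSystem M V) (u : W),
        cs.length (x * u) = cs.length x + cs.length u ↔
          R.inversionRoots cs u ∩ R.inversionRoots cs x⁻¹ = ∅) := by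
  let _ : PartialOrder W := cs.weakOrder
  refine ⟨⟨{ toFun := fun u => ⟨x * u, ?_⟩
             invFun := fun z => ⟨x⁻¹ * z, ?_⟩
             left_inv := fun u => Subtype.ext (inv_mul_cancel_left x u)
             right_inv := fun z => Subtype.ext (mul_inv_cancel_left x z)
             map_rel_iff' := fun {u v} => cs.mul_le_mul_iff_of_length u.2 v.2 }, fun _ => rfl⟩,
    ?_, fun _ _ h h' => le_trans h' h, fun U y hU hy => cs.length_mul_of_isLUB hU hy,
    fun R u => R.length_mul_eq_add_iff cs x u⟩
  · change cs.length (x * u) = cs.length x + cs.length (x⁻¹ * (x * u))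
    rw [inv_mul_cancel_left]
    exact u.2
  · change cs.length (x * (x⁻¹ * z)) = cs.length x + cs.length (x⁻¹ * z)
    rw [mul_inv_cancel_left]
    exact z.2
  · intro v u huv hv
    have huv' := cs.weakOrder_le_iff.1 huv
    have h₁ := cs.length_mul_le (x * u) (u⁻¹ * v)
    have h₂ := cs.length_mul_le x u
    rw [show x * u * (u⁻¹ * v) = x * v by group] at h₁
    change cs.length (x * v) = cs.length x + cs.length v at hv
    change cs.length (x * u) = cs.length x + cs.length u
    omega
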